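/- Let $A$ be an $N\times N$ and $B$ an $M\times M$ irreducible, non-permutation matrix with entries in $\{0,1\}$. Let $\bar X_A=\{(x_n)_{n\in\mathbb Z}\in\{1,\dots,N\}^{\mathbb Z} : A(x_n,x_{n+1})=1 \text{ for all } n\}$, with the product topology, given by the metric $d(x,y)=2^{-m}$ for $x\neq y$, where $m$ is the largest $n\ge 0$ such that $x_k=y_k$ for all $|k|<n$, and let $\bar\sigma_A$ be the shift $\bar\sigma_A(x)_n=x_{n+1}$; similarly $(\bar X_B,\bar\sigma_B)$. Let $G_A^s$ and $G_A^u$ be the sets of pairs $(x,y)\in\bar X_A\times\bar X_A$ with $d(\bar\sigma_A^n x,\bar\sigma_A^n y)\to 0$ as $n\to\infty$, respectively as $n\to-\infty$. Give $G_A^s$ the inductive limit topology of its subspaces $\{(x,y): x_i=y_i \text{ for all } i\ge n\}\subset \bar X_A\times\bar X_A$, $n\geq 0$, and $G_A^u$ that of its subspaces $\{(x,y): x_i=y_i \text{ for all } i\le -n\}$, $n\ge 0$. Let $$G_A^{s,u}\rtimes\mathbb Z^2=\{(x,p,q,y)\in \bar X_A\times\mathbb Z\times\mathbb Z\times\bar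 X_A : (\bar\sigma_A^p x,y)\in G_A^s,\ (\bar\sigma_A^q x,y)\in G_A^u\}$$ be the étale groupoid with range $r(x,p,q,y)=x$, source $s(x,p,q,y)=y$, product $(x,p,q,y)(y,p',q',z)=(x,p+p',q+q',z)$, inverse $(x,p,q,y)^{-1}=(y,-p,-q,x)$, and the topology induced from $G_A^s\times G_A^u\times\mathbb Z^2$ by the injection $(x,p,q,y)\mapsto((\bar\sigma_A^p x,y),(\bar\sigma_A^q x,y),p,q)$. The extended Ruelle algebra $\widetilde{\mathcal R}_A=C^*(G_A^{s,u}\rtimes\mathbb Z^2)$ is its (reduced) groupoid $C^*$-algebra: the norm closure of the operators $\xi\mapsto a*\xi$, $(a*\xi)(\gamma)=\sum_{r(\eta)=r(\gamma)}a(\eta)\,\xi(\eta^{-1}\gamma)$, on $\ell^2(G_A^{s,u}\rtimes\mathbb Z^2)$, for $a\in C_c(G_A^{s,u}\rtimes\mathbb Z^2)$. A function $h\in C(\bar X_A)$ is regarded as the element of $C_c(G_A^{s,u}\rtimes\mathbb Z^2)\subset\widetilde{\mathcal R}_A$ with value $h(x)$ at $(x,0,0,x)$ and $0$ elsewhere,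 so that $C(\bar X_A)\subset\widetilde{\mathcal R}_A$. For $f\in C(\bar X_A,\mathbb Z)$ put $f^n=\sum_{i=0}^{n-1}f\circ\bar\sigma_A^i$ for $n\ge1$, $f^0=0$, $f^n=-\sum_{i=n}^{-1}f\circ\bar\sigma_A^i$ for $n\le-1$, and $$\tilde f^+(x,p,q,y)=\lim_{n\to\infty}\{f^{n+p}(\bar\sigma_A x)-f^n(\bar\sigma_A y)\},\qquad \tilde f^-(x,p,q,y)=\lim_{n\to-\infty}\{f^{n+q}(x)-f^n(y)\}.$$ For $(r,s)\in\mathbb T^2=(\mathbb R/\mathbb Z)^2$ let $U_{(r,s)}(\tilde f)$ be the unitary operator on $\ell^2(G_A^{s,u}\rtimes\mathbb Z^2)$ of multiplication by the function $\gamma\mapsto\exp\{2\pi\sqrt{-1}(\tilde f^+(\gamma)s+\tilde f^-(\gamma)r)\}$, and let $\gamma^{A,f}_{(r,s)}\in\operatorname{Aut}(\widetilde{\mathcal R}_A)$ be the automorphism $a\mapsto U_{(r,s)}(\tilde f)\,a\,U_{(r,s)}(\tilde f)^*$. The same notation is used for $B$. **Proposition.** Let $\varphi:\bar X_A\to\bar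 X_B$ be a topological conjugacy, that is, a homeomorphism with $\varphi\circ\bar\sigma_A=\bar\sigma_B\circ\varphi$, and suppose that $f\in C(\bar X_A,\mathbb Z)$ and $g\in C(\bar X_B,\mathbb Z)$ satisfy $f=g\circ\varphi$. Then there exists an isomorphism $\Phi:\widetilde{\mathcal R}_A\to\widetilde{\mathcal R}_B$ of $C^*$-algebras such that $$\Phi(C(\bar X_A))=C(\bar X_B),\qquad \Phi\circ\gamma^{A,f}_{(r,s)}=\gamma^{B,g}_{(r,s)}\circ\Phi\quad\text{for all }(r,s)\in\mathbb T^2.$$ -/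

import Mathlib

noncomputable section

open Filter Topology
open scoped ENNReal CompactlySupported

namespace MarkovShift

/-! ### Two-sided topological Markov shifts -/

/-- The two-sided shift space of a `0`-`1` matrix `A`: the bi-infinite sequences
`(x n)_{n ∈ ℤ}` with `A (x n) (x (n + 1)) = 1` for all `n`, with the product topology. -/
abbrev ShiftSpace {N : ℕ} (A : Matrix (Fin N) (Fin N) ℤ) : Type :=
  {x : ℤ → Fin N // ∀ n : ℤ, A (x n) (x (n + 1)) = 1}

variable {N : ℕ} {A : Matrix (Fin N) (Fin N) ℤ}

/-- The `n`-th power (`n ∈ ℤ`) of the shift homeomorphism: `(σⁿ x)_k = x_{k + n}`. -/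
def shiftZ (n : ℤ) (x : ShiftSpace A) : ShiftSpace A :=
  ⟨fun k => x.1 (k + n), fun k => by
    have h := x.2 (k + n)
    rwa [show k + n + 1 = k + 1 + n by ring] at h⟩

/-- The shift transformation `σ`, `(σ x)_k = x_{k + 1}`. -/
def shift (x : ShiftSpace A) : ShiftSpace A := shiftZ 1 x

theorem shiftZ_shiftZ (m n : ℤ) (x : ShiftSpace A) :
    shiftZ m (shiftZ n x) = shiftZ (m + n) x := by
  apply Subtype.ext; funext k; simp [shiftZ, add_assoc]

theorem shiftZ_zero (x : ShiftSpace A) : shiftZ 0 x = x := by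
  apply Subtype.ext; funext k; simp [shiftZ]

theorem continuous_shiftZ (n : ℤ) : Continuous (shiftZ n : ShiftSpace A → ShiftSpace A) := by
  apply Continuous.subtype_mk
  exact continuous_pi fun k => (continuous_apply (k + n)).comp continuous_subtype_val

/-- The shift space is compact. -/
instance instCompactSpace : CompactSpace (ShiftSpace A) := by
  apply isCompact_iff_compactSpace.mp
  apply IsClosed.isCompact
  have : {x : ℤ → Fin N | ∀ n : ℤ, A (x n) (x (n + 1)) = 1}
      = ⋂ n : ℤ, (fun x : ℤ → Fin N => A (x n) (x (n + 1))) ⁻¹' {1} := by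
    ext x; simp
  show IsClosed {x : ℤ → Fin N | ∀ n : ℤ, A (x n) (x (n + 1)) = 1}
  rw [this]
  refine isClosed_iInter fun n => IsClosed.preimage ?_ (isClosed_discrete _)
  have h2 : Continuous fun z : Fin N × Fin N => A z.1 z.2 := continuous_of_discreteTopology
  exact h2.comp (Continuous.prodMk (continuous_apply (A := fun _ : ℤ => Fin N) n)
    (continuous_apply (A := fun _ : ℤ => Fin N) (n + 1)))

/-- The usual metric of the shift space: `d (x, y) = λ ^ m` where `m` is the largest `n` such that
`x_k = y_k` for all `|k| < n` (so `d (x, y) = 1` if `x_0 ≠ y_0`), and `d (x, x) = 0`;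
the ratio `0 < λ < 1` is fixed to be `1 / 2`. -/
def shiftDist (x y : ShiftSpace A) : ℝ :=
  open Classical in
  if x = y then 0 else (1 / 2 : ℝ) ^ sSup {n : ℕ | ∀ k : ℤ, |k| < n → x.1 k = y.1 k}

/-- Stable equivalence: `d (σⁿ x, σⁿ y) → 0` as `n → ∞`. -/
def Stable (x y : ShiftSpace A) : Prop :=
  Tendsto (fun n : ℤ => shiftDist (shiftZ n x) (shiftZ n y)) atTop (𝓝 0)

/-- Unstable equivalence: `d (σⁿ x, σⁿ y) → 0` as `n → -∞`. -/
def Unstable (x y : ShiftSpace A) : Prop :=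
  Tendsto (fun n : ℤ => shiftDist (shiftZ n x) (shiftZ n y)) atBot (𝓝 0)

theorem shiftDist_nonneg (x y : ShiftSpace A) : 0 ≤ shiftDist x y := by
  unfold shiftDist; split_ifs <;> positivity

theorem shiftDist_le {x y : ShiftSpace A} {M : ℕ} (h : ∀ k : ℤ, |k| < M → x.1 k = y.1 k) :
    shiftDist x y ≤ (1 / 2 : ℝ) ^ M := by
  unfold shiftDist
  split_ifs with hxy
  · positivity
  · refine pow_le_pow_of_le_one (by norm_num) (by norm_num) (le_csSup ?_ h)
    by_contra hb
    apply hxy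
    apply Subtype.ext
    funext k
    rw [not_bddAbove_iff] at hb
    obtain ⟨m, hm, hkm⟩ := hb k.natAbs
    exact hm k (by rw [Int.abs_eq_natAbs]; exact_mod_cast hkm)

theorem shiftDist_eq_one {x y : ShiftSpace A} (h : x.1 0 ≠ y.1 0) : shiftDist x y = 1 := by
  have hxy : x ≠ y := fun e => h (by rw [e])
  have hs : {n : ℕ | ∀ k : ℤ, |k| < n → x.1 k = y.1 k} = {0} := by
    ext n
    simp only [Set.mem_ofPred_eq, Set.mem_singleton_iff]
    constructor
    · intro hn
      by_contra h0
      exact h (hn 0 (by simpa using Nat.pos_of_ne_zero h0))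
    · rintro rfl k hk
      simp only [Nat.cast_zero] at hk
      exact absurd hk (not_lt.mpr (abs_nonneg k))
  unfold shiftDist
  rw [if_neg hxy, hs]
  simp

theorem stable_iff {x y : ShiftSpace A} :
    Stable x y ↔ ∃ n : ℕ, ∀ i : ℤ, (n : ℤ) ≤ i → x.1 i = y.1 i := by
  constructor
  · intro h
    have h1 := h.eventually (gt_mem_nhds (show (0 : ℝ) < 1 by norm_num))
    obtain ⟨n, hn⟩ := eventually_atTop.mp h1
    refine ⟨n.toNat, fun i hi => ?_⟩
    by_contra hne
    refine absurd (hn i (by omega)) (not_lt.mpr (le_of_eq (shiftDist_eq_one ?_).symm))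
    simpa [shiftZ] using hne
  · rintro ⟨n, hn⟩
    refine squeeze_zero' (Eventually.of_forall fun _ => shiftDist_nonneg _ _)
      (g := fun j : ℤ => (1 / 2 : ℝ) ^ (j - n).toNat) ?_ ?_
    · filter_upwards [eventually_ge_atTop (n : ℤ)] with j hj
      refine shiftDist_le fun k hk => hn (k + j) ?_
      rw [abs_lt] at hk
      omega
    · refine (tendsto_pow_atTop_nhds_zero_of_lt_one (by norm_num) (by norm_num)).comp ?_
      refine tendsto_atTop.mpr fun b => ?_
      filter_upwards [eventually_ge_atTop ((n : ℤ) + b)] with j hj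
      omega

theorem unstable_iff {x y : ShiftSpace A} :
    Unstable x y ↔ ∃ n : ℕ, ∀ i : ℤ, i ≤ -(n : ℤ) → x.1 i = y.1 i := by
  constructor
  · intro h
    have h1 := h.eventually (gt_mem_nhds (show (0 : ℝ) < 1 by norm_num))
    obtain ⟨n, hn⟩ := eventually_atBot.mp h1
    refine ⟨(-n).toNat, fun i hi => ?_⟩
    by_contra hne
    refine absurd (hn i (by omega)) (not_lt.mpr (le_of_eq (shiftDist_eq_one ?_).symm))
    simpa [shiftZ] using hne
  · rintro ⟨n, hn⟩
    refine squeeze_zero' (Eventually.of_forall fun _ => shiftDist_nonneg _ _)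
      (g := fun j : ℤ => (1 / 2 : ℝ) ^ (-j - n).toNat) ?_ ?_
    · filter_upwards [eventually_le_atBot (-(n : ℤ))] with j hj
      refine shiftDist_le fun k hk => hn (k + j) ?_
      rw [abs_lt] at hk
      omega
    · refine (tendsto_pow_atTop_nhds_zero_of_lt_one (by norm_num) (by norm_num)).comp ?_
      refine tendsto_atTop.mpr fun b => ?_
      filter_upwards [eventually_le_atBot (-((n : ℤ) + b))] with j hj
      omega

theorem Stable.symm {x y : ShiftSpace A} (h : Stable x y) : Stable y x := by
  rw [stable_iff] at *
  exact h.imp fun n hn i hi => (hn i hi).symm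

theorem Unstable.symm {x y : ShiftSpace A} (h : Unstable x y) : Unstable y x := by
  rw [unstable_iff] at *
  exact h.imp fun n hn i hi => (hn i hi).symm

theorem Stable.trans {x y z : ShiftSpace A} (h : Stable x y) (h' : Stable y z) : Stable x z := by
  rw [stable_iff] at *
  obtain ⟨n, hn⟩ := h
  obtain ⟨m, hm⟩ := h'
  exact ⟨n + m, fun i hi => (hn i (by omega)).trans (hm i (by omega))⟩

theorem Unstable.trans {x y z : ShiftSpace A} (h : Unstable x y) (h' : Unstable y z) :
    Unstable x z := by
  rw [unstable_iff] at *
  obtain ⟨n, hn⟩ := h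
  obtain ⟨m, hm⟩ := h'
  exact ⟨n + m, fun i hi => (hn i (by omega)).trans (hm i (by omega))⟩

theorem Stable.shiftZ {x y : ShiftSpace A} (h : Stable x y) (k : ℤ) :
    Stable (shiftZ k x) (shiftZ k y) := by
  have := h.comp (tendsto_atTop_add_const_right atTop k tendsto_id)
  simpa only [Stable, Function.comp_def, shiftZ_shiftZ, id] using this

theorem Unstable.shiftZ {x y : ShiftSpace A} (h : Unstable x y) (k : ℤ) :
    Unstable (shiftZ k x) (shiftZ k y) := by
  have := h.comp (tendsto_atBot_add_const_right atBot k tendsto_id)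
  simpa only [Unstable, Function.comp_def, shiftZ_shiftZ, id] using this

theorem Stable.refl (x : ShiftSpace A) : Stable x x := stable_iff.mpr ⟨0, fun _ _ => rfl⟩

theorem Unstable.refl (x : ShiftSpace A) : Unstable x x := unstable_iff.mpr ⟨0, fun _ _ => rfl⟩

/-! ### The stable and unstable groupoids with their inductive limit topologies -/

/-- The inductive limit topology on a set `S = ⋃ₙ E n` of points of a space `Z`, each `E n`
carrying the relative topology of `Z`: a set is open iff its trace on every `E n` is open. -/
abbrev indLim {Z : Type} [TopologicalSpace Z] (S : Set Z) (E : ℕ → Set Z) : TopologicalSpace S :=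
  ⨆ n : ℕ, TopologicalSpace.coinduced
    (fun z : {z : S // (z : Z) ∈ E n} => (z : S))
    (TopologicalSpace.induced (fun z : {z : S // (z : Z) ∈ E n} => ((z : S) : Z)) inferInstance)

theorem isOpen_indLim {Z : Type} [TopologicalSpace Z] {S : Set Z} {E : ℕ → Set Z} {U : Set S} :
    IsOpen[indLim S E] U ↔
      ∀ n, ∃ V : Set Z, IsOpen V ∧ ∀ z : S, (z : Z) ∈ E n → (z ∈ U ↔ (z : Z) ∈ V) := by
  unfold indLim
  rw [isOpen_iSup_iff]
  refine forall_congr' fun n => ?_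
  rw [isOpen_coinduced, isOpen_induced_iff]
  refine exists_congr fun V => and_congr_right fun _ => ?_
  constructor
  · intro h z hz
    have := Set.ext_iff.mp h ⟨z, hz⟩
    exact this.symm
  · intro h
    ext ⟨z, hz⟩
    exact (h z hz).symm

theorem continuous_val_indLim {Z : Type} [TopologicalSpace Z] (S : Set Z) (E : ℕ → Set Z) :
    @Continuous S Z (indLim S E) _ Subtype.val := by
  refine @Continuous.mk _ _ (indLim S E) _ _ fun V hV => ?_
  rw [isOpen_indLim]
  exact fun n => ⟨V, hV, fun z _ => Iff.rfl⟩

/-- The pairs `(x, y)` with `(σⁿ x, σⁿ y) ∈ G^{s,0}`, that is, `x_i = y_i` for all `i ≥ n`. -/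
def levelS (A : Matrix (Fin N) (Fin N) ℤ) (n : ℕ) : Set (ShiftSpace A × ShiftSpace A) :=
  {z | ∀ i : ℤ, (n : ℤ) ≤ i → z.1.1 i = z.2.1 i}

/-- The pairs `(x, y)` with `(σ⁻ⁿ x, σ⁻ⁿ y) ∈ G^{u,0}`, that is, `x_i = y_i` for all `i ≤ -n`. -/
def levelU (A : Matrix (Fin N) (Fin N) ℤ) (n : ℕ) : Set (ShiftSpace A × ShiftSpace A) :=
  {z | ∀ i : ℤ, i ≤ -(n : ℤ) → z.1.1 i = z.2.1 i}

/-- The stable groupoid `G_A^s`, as a set of pairs. -/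
def StableRel (A : Matrix (Fin N) (Fin N) ℤ) : Set (ShiftSpace A × ShiftSpace A) :=
  {z | Stable z.1 z.2}

/-- The unstable groupoid `G_A^u`, as a set of pairs. -/
def UnstableRel (A : Matrix (Fin N) (Fin N) ℤ) : Set (ShiftSpace A × ShiftSpace A) :=
  {z | Unstable z.1 z.2}

theorem stableRel_eq_iUnion : StableRel A = ⋃ n, levelS A n := by
  ext z; simp only [StableRel, levelS, Set.mem_iUnion, Set.mem_ofPred_eq, stable_iff]

theorem unstableRel_eq_iUnion : UnstableRel A = ⋃ n, levelU A n := by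
  ext z; simp only [UnstableRel, levelU, Set.mem_iUnion, Set.mem_ofPred_eq, unstable_iff]

/-- `G_A^s` as a topological space: the inductive limit of the sets `levelS A n`. -/
def Gs (A : Matrix (Fin N) (Fin N) ℤ) : Type := StableRel A

/-- `G_A^u` as a topological space: the inductive limit of the sets `levelU A n`. -/
def Gu (A : Matrix (Fin N) (Fin N) ℤ) : Type := UnstableRel A

instance instTopGs : TopologicalSpace (Gs A) := indLim (StableRel A) (levelS A)

instance instTopGu : TopologicalSpace (Gu A) := indLim (UnstableRel A) (levelU A)

/-! ### The groupoid `G_A^{s,u} ⋊ ℤ²` -/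

/-- The groupoid `G_A^{s,u} ⋊ ℤ²` of the quadruples `(x, p, q, y)` such that `(σᵖ x, y) ∈ G_A^s` and
`(σ^q x, y) ∈ G_A^u`. The range of `(x, p, q, y)` is `x`, its source is `y`. -/
@[ext]
structure Gsu (A : Matrix (Fin N) (Fin N) ℤ) : Type where
  x : ShiftSpace A
  p : ℤ
  q : ℤ
  y : ShiftSpace A
  stable : Stable (shiftZ p x) y
  unstable : Unstable (shiftZ q x) y

namespace Gsu

/-- The product `(x, p, q, y) (y, p', q', z) = (x, p + p', q + q', z)`. -/
def mul (g h : Gsu A) (e : g.y = h.x) : Gsu A where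
  x := g.x
  p := g.p + h.p
  q := g.q + h.q
  y := h.y
  stable := by
    have h1 := g.stable.shiftZ h.p
    rw [shiftZ_shiftZ, e, add_comm] at h1
    exact h1.trans h.stable
  unstable := by
    have h1 := g.unstable.shiftZ h.q
    rw [shiftZ_shiftZ, e, add_comm] at h1
    exact h1.trans h.unstable

/-- The inverse `(x, p, q, y)⁻¹ = (y, -p, -q, x)`. -/
def inv (g : Gsu A) : Gsu A where
  x := g.y
  p := -g.p
  q := -g.q
  y := g.x
  stable := by
    have h1 := (g.stable.shiftZ (-g.p)).symm
    rwa [shiftZ_shiftZ, neg_add_cancel, shiftZ_zero] at h1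
  unstable := by
    have h1 := (g.unstable.shiftZ (-g.q)).symm
    rwa [shiftZ_shiftZ, neg_add_cancel, shiftZ_zero] at h1

/-- The unit `(x, 0, 0, x)`. -/
def unit (x : ShiftSpace A) : Gsu A where
  x := x
  p := 0
  q := 0
  y := x
  stable := by rw [shiftZ_zero]; exact Stable.refl x
  unstable := by rw [shiftZ_zero]; exact Unstable.refl x

/-- `(x, p, q, y) ↦ ((σᵖ x, y), (σ^q x, y), p, q) ∈ G_A^s × G_A^u × ℤ × ℤ`. -/
def toProd (g : Gsu A) : Gs A × Gu A × ℤ × ℤ :=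
  (⟨(shiftZ g.p g.x, g.y), g.stable⟩, ⟨(shiftZ g.q g.x, g.y), g.unstable⟩, g.p, g.q)

/-- The topology of `G_A^{s,u} ⋊ ℤ²`, as a subspace of `G_A^s × G_A^u × ℤ × ℤ`. -/
instance instTopGsu : TopologicalSpace (Gsu A) :=
  TopologicalSpace.induced toProd inferInstance

theorem continuous_toProd : Continuous (toProd : Gsu A → _) := continuous_induced_dom

theorem continuous_p : Continuous (p : Gsu A → ℤ) :=
  continuous_fst.comp (continuous_snd.comp (continuous_snd.comp continuous_toProd))

theorem continuous_q : Continuous (q : Gsu A → ℤ) :=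
  continuous_snd.comp (continuous_snd.comp (continuous_snd.comp continuous_toProd))

theorem continuous_toGs : Continuous (fun g : Gsu A => g.toProd.1) :=
  continuous_fst.comp continuous_toProd

theorem continuous_toGu : Continuous (fun g : Gsu A => g.toProd.2.1) :=
  continuous_fst.comp (continuous_snd.comp continuous_toProd)

theorem continuous_pairS :
    Continuous (fun g : Gsu A => ((shiftZ g.p g.x, g.y) : ShiftSpace A × ShiftSpace A)) :=
  (show Continuous (fun z : Gs A => z.1) from
    continuous_val_indLim (StableRel A) (levelS A)).comp continuous_toGs

theorem continuous_y : Continuous (y : Gsu A → ShiftSpace A) :=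
  continuous_snd.comp continuous_pairS

theorem continuous_shiftZ_uncurry :
    Continuous (fun z : ℤ × ShiftSpace A => shiftZ z.1 z.2) :=
  continuous_prod_of_discrete_left.mpr continuous_shiftZ

theorem continuous_x : Continuous (x : Gsu A → ShiftSpace A) := by
  have h : Continuous (fun g : Gsu A => shiftZ (-g.p) (shiftZ g.p g.x)) :=
    continuous_shiftZ_uncurry.comp
      (continuous_p.neg.prodMk (continuous_fst.comp continuous_pairS))
  simpa only [shiftZ_shiftZ, neg_add_cancel, shiftZ_zero] using h

theorem isOpen_agree (a b : ℤ) :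
    IsOpen {z : ShiftSpace A × ShiftSpace A | ∀ i ∈ Set.Icc a b, z.1.1 i = z.2.1 i} := by
  have : {z : ShiftSpace A × ShiftSpace A | ∀ i ∈ Set.Icc a b, z.1.1 i = z.2.1 i}
      = ⋂ i ∈ Set.Icc a b, {z | z.1.1 i = z.2.1 i} := by ext z; simp
  rw [this]
  refine (Set.finite_Icc a b).isOpen_biInter fun i _ => ?_
  have h : Continuous (fun z : ShiftSpace A × ShiftSpace A => (z.1.1 i, z.2.1 i)) :=
    (((continuous_apply i).comp continuous_subtype_val).comp continuous_fst).prodMk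
      (((continuous_apply i).comp continuous_subtype_val).comp continuous_snd)
  exact h.isOpen_preimage {w | w.1 = w.2} (isOpen_discrete _)

theorem isOpen_levelS (n : ℕ) : IsOpen {z : Gs A | z.1 ∈ levelS A n} := by
  refine isOpen_indLim.mpr fun m => ⟨_, isOpen_agree (n : ℤ) m, fun z hz => ?_⟩
  constructor
  · exact fun h i hi => h i hi.1
  · intro h i hi
    by_cases him : i ≤ m
    · exact h i ⟨hi, him⟩
    · exact hz i (by omega)

theorem isOpen_levelU (n : ℕ) : IsOpen {z : Gu A | z.1 ∈ levelU A n} := by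
  refine isOpen_indLim.mpr fun m => ⟨_, isOpen_agree (-(m : ℤ)) (-(n : ℤ)), fun z hz => ?_⟩
  constructor
  · exact fun h i hi => h i hi.2
  · intro h i hi
    by_cases him : -(m : ℤ) ≤ i
    · exact h i ⟨him, hi⟩
    · exact hz i (by omega)

/-- The open sets of those `(x, p, q, y)` with fixed `p`, `q` for which `σᵖ x`, `y` agree from `n`
on and `σ^q x`, `y` agree up to `-m`. -/
def box (A : Matrix (Fin N) (Fin N) ℤ) (p q : ℤ) (n m : ℕ) : Set (Gsu A) :=
  {g | g.p = p ∧ g.q = q ∧ (shiftZ g.p g.x, g.y) ∈ levelS A n ∧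
    (shiftZ g.q g.x, g.y) ∈ levelU A m}

theorem isOpen_box (p q : ℤ) (n m : ℕ) : IsOpen (box A p q n m) :=
  ((isOpen_discrete {p}).preimage continuous_p).inter <|
    ((isOpen_discrete {q}).preimage continuous_q).inter <|
      ((isOpen_levelS n).preimage continuous_toGs).inter
        ((isOpen_levelU m).preimage continuous_toGu)

theorem exists_mem_box (g : Gsu A) : ∃ n m : ℕ, g ∈ box A g.p g.q n m := by
  obtain ⟨n, hn⟩ := stable_iff.mp g.stable
  obtain ⟨m, hm⟩ := unstable_iff.mp g.unstable
  exact ⟨n, m, rfl, rfl, hn, hm⟩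

/-- The range and source maps are locally injective. -/
theorem exists_isOpen_injOn (g : Gsu A) :
    ∃ U : Set (Gsu A), IsOpen U ∧ g ∈ U ∧ Set.InjOn x U ∧ Set.InjOn y U := by
  obtain ⟨n, m, hg⟩ := exists_mem_box g
  set a : ℤ := -(m : ℤ) - |g.p| - |g.q| with ha
  set b : ℤ := (n : ℤ) + |g.p| + |g.q| with hb
  have hp1 := le_abs_self g.p
  have hp2 := neg_abs_le g.p
  have hq1 := le_abs_self g.q
  have hq2 := neg_abs_le g.q
  have hx : IsOpen {h : Gsu A | ∀ i ∈ Set.Icc a b, h.x.1 i = g.x.1 i} :=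
    (isOpen_agree a b).preimage (continuous_x.prodMk continuous_const)
  have hy : IsOpen {h : Gsu A | ∀ i ∈ Set.Icc a b, h.y.1 i = g.y.1 i} :=
    (isOpen_agree a b).preimage (continuous_y.prodMk continuous_const)
  refine ⟨box A g.p g.q n m ∩ ({h | ∀ i ∈ Set.Icc a b, h.x.1 i = g.x.1 i} ∩
    {h | ∀ i ∈ Set.Icc a b, h.y.1 i = g.y.1 i}), (isOpen_box _ _ _ _).inter (hx.inter hy),
    ⟨hg, fun _ _ => rfl, fun _ _ => rfl⟩, ?_, ?_⟩
  · rintro h ⟨⟨hp, hq, hs, hu⟩, hhx, hhy⟩ k ⟨⟨kp, kq, ks, ku⟩, kx, ky⟩ e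
    have : h.y = k.y := by
      apply Subtype.ext
      funext i
      by_cases h1 : (n : ℤ) ≤ i
      · have e1 := hs i h1
        have e2 := ks i h1
        simp only [shiftZ, hp, kp, e] at e1 e2
        rw [← e1, ← e2]
      by_cases h2 : i ≤ -(m : ℤ)
      · have e1 := hu i h2
        have e2 := ku i h2
        simp only [shiftZ, hq, kq, e] at e1 e2
        rw [← e1, ← e2]
      · rw [hhy i ⟨by omega, by omega⟩, ky i ⟨by omega, by omega⟩]
    exact Gsu.ext e (hp.trans kp.symm) (hq.trans kq.symm) this
  · rintro h ⟨⟨hp, hq, hs, hu⟩, hhx, hhy⟩ k ⟨⟨kp, kq, ks, ku⟩, kx, ky⟩ e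
    have : h.x = k.x := by
      apply Subtype.ext
      funext i
      by_cases h1 : (n : ℤ) ≤ i - g.p
      · have e1 := hs _ h1
        have e2 := ks _ h1
        simp only [shiftZ, hp, kp, e, sub_add_cancel] at e1 e2
        rw [e1, e2]
      by_cases h2 : i - g.q ≤ -(m : ℤ)
      · have e1 := hu _ h2
        have e2 := ku _ h2
        simp only [shiftZ, hq, kq, e, sub_add_cancel] at e1 e2
        rw [e1, e2]
      · rw [hhx i ⟨by omega, by omega⟩, kx i ⟨by omega, by omega⟩]
    exact Gsu.ext this (hp.trans kp.symm) (hq.trans kq.symm) e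

end Gsu

/-! ### The left regular representation and the extended Ruelle algebra -/

namespace Gsu

/-- The convolution `(a * ξ)(γ) = ∑_{η : r(η) = r(γ)} a(η) ξ(η⁻¹ γ)`. -/
def conv (a ξ : Gsu A → ℂ) (γ : Gsu A) : ℂ :=
  ∑' η : {η : Gsu A // η.x = γ.x}, a η.1 * ξ (mul (inv η.1) γ η.2)

/-- Reindexing `(γ, η) ↦ (η⁻¹ γ, η)`. -/
def reindex (A : Matrix (Fin N) (Fin N) ℤ) :
    (Σ γ : Gsu A, {η : Gsu A // η.x = γ.x}) ≃ (Σ δ : Gsu A, {η : Gsu A // η.y = δ.x}) where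
  toFun z := ⟨mul (inv z.2.1) z.1 z.2.2, ⟨z.2.1, rfl⟩⟩
  invFun z := ⟨mul z.2.1 z.1 z.2.2, ⟨z.2.1, rfl⟩⟩
  left_inv := by
    rintro ⟨⟨x, p, q, y, hs, hu⟩, ⟨η, e⟩⟩
    obtain rfl : η.x = x := e
    have : mul η (mul (inv η) ⟨η.x, p, q, y, hs, hu⟩ rfl) rfl = ⟨η.x, p, q, y, hs, hu⟩ := by
      apply Gsu.ext <;> simp [mul, inv]
    exact Sigma.subtype_ext this rfl
  right_inv := by
    rintro ⟨⟨x, p, q, y, hs, hu⟩, ⟨η, e⟩⟩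
    obtain rfl : η.y = x := e
    have : mul (inv η) (mul η ⟨η.y, p, q, y, hs, hu⟩ rfl) rfl = ⟨η.y, p, q, y, hs, hu⟩ := by
      apply Gsu.ext <;> simp [mul, inv]
    exact Sigma.subtype_ext this rfl

/-- A compactly supported function is summable along the fibres of the range and source maps, with
a uniform bound. -/
theorem exists_fibre_bound (a : C_c(Gsu A, ℂ)) :
    ∃ L : ℝ≥0∞, L ≠ ⊤ ∧
      (∀ z, ∑' η : {η : Gsu A // η.x = z}, ‖a η.1‖ₑ ≤ L) ∧
      (∀ z, ∑' η : {η : Gsu A // η.y = z}, ‖a η.1‖ₑ ≤ L) := by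
  choose U hUo hUm hUx hUy using exists_isOpen_injOn (A := A)
  have hK : IsCompact (tsupport a) := a.hasCompactSupport
  obtain ⟨t, ht⟩ := hK.elim_finite_subcover U hUo (fun g _ => Set.mem_iUnion.mpr ⟨g, hUm g⟩)
  obtain ⟨C, hC⟩ := a.hasCompactSupport.exists_bound_of_continuous a.continuous
  have hCe : ∀ η, ‖a η‖ₑ ≤ ENNReal.ofReal C := fun η => by
    rw [← ofReal_norm]; exact ENNReal.ofReal_le_ofReal (hC η)
  have key : ∀ (π : Gsu A → ShiftSpace A), (∀ g, Set.InjOn π (U g)) →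
      ∀ z, ∑' η : {η : Gsu A // π η = z}, ‖a η.1‖ₑ ≤ t.card * ENNReal.ofReal C := by
    intro π hπ z
    have h1 : ∀ η : {η : Gsu A // π η = z},
        ‖a η.1‖ₑ ≤ ∑ g ∈ t, (U g).indicator (fun η => ‖a η‖ₑ) η.1 := by
      intro η
      by_cases h0 : a η.1 = 0
      · simp [h0]
      obtain ⟨g, hg⟩ := Set.mem_iUnion.mp (ht (subset_tsupport _ h0))
      obtain ⟨hgt, hg⟩ := Set.mem_iUnion.mp hg
      calc ‖a η.1‖ₑ = (U g).indicator (fun η => ‖a η‖ₑ) η.1 := by rw [Set.indicator_of_mem hg]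
        _ ≤ _ := Finset.single_le_sum
          (f := fun g => (U g).indicator (fun η => ‖a η‖ₑ) η.1) (fun _ _ => zero_le) hgt
    refine (ENNReal.tsum_le_tsum h1).trans ?_
    rw [Summable.tsum_finsetSum fun _ _ => ENNReal.summable, ← nsmul_eq_mul]
    refine Finset.sum_le_card_nsmul _ _ _ fun g _ => ?_
    by_cases hex : ∃ η : {η : Gsu A // π η = z}, η.1 ∈ U g
    · obtain ⟨η₀, h₀⟩ := hex
      rw [tsum_eq_single η₀]
      · rw [Set.indicator_of_mem h₀]; exact hCe _
      · intro η hne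
        refine Set.indicator_of_notMem (fun hmem => hne ?_) _
        exact Subtype.ext (hπ g hmem h₀ (η.2.trans η₀.2.symm))
    · rw [ENNReal.tsum_eq_zero.mpr]
      · exact zero_le
      · intro η
        exact Set.indicator_of_notMem (fun hmem => hex ⟨η, hmem⟩) _
  exact ⟨t.card * ENNReal.ofReal C, ENNReal.mul_ne_top (ENNReal.natCast_ne_top _)
    ENNReal.ofReal_ne_top, key x hUx, key y hUy⟩

theorem tsum_mul_sq_le {ι : Type} (u v : ι → ℝ≥0∞) :
    (∑' i, u i * v i) ^ 2 ≤ (∑' i, u i) * ∑' i, u i * v i ^ 2 := by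
  have h : ∀ s : Finset ι, (∑ i ∈ s, u i * v i) ^ 2 ≤ (∑' i, u i) * ∑' i, u i * v i ^ 2 := by
    intro s
    have h1 := ENNReal.inner_le_Lp_mul_Lq s (fun i => u i ^ (1 / 2 : ℝ))
      (fun i => u i ^ (1 / 2 : ℝ) * v i) (p := 2) (q := 2) Real.HolderConjugate.two_two
    have e1 : ∀ c : ℝ≥0∞, c ^ (1 / 2 : ℝ) * c ^ (1 / 2 : ℝ) = c := fun c => by
      rw [← ENNReal.rpow_add_of_nonneg _ _ (by norm_num) (by norm_num)]; norm_num
    have e2 : ∀ c : ℝ≥0∞, (c ^ (1 / 2 : ℝ)) ^ (2 : ℝ) = c := fun c => by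
      rw [← ENNReal.rpow_mul]; norm_num
    simp only [← mul_assoc, e1, ENNReal.mul_rpow_of_nonneg _ _ (show (0 : ℝ) ≤ 2 by norm_num),
      e2] at h1
    calc (∑ i ∈ s, u i * v i) ^ 2
        ≤ ((∑ i ∈ s, u i) ^ (1 / 2 : ℝ) * (∑ i ∈ s, u i * v i ^ (2 : ℝ)) ^ (1 / 2 : ℝ)) ^ 2 := by
          gcongr
      _ = (∑ i ∈ s, u i) * ∑ i ∈ s, u i * v i ^ 2 := by
          rw [mul_pow, pow_two, pow_two, e1, e1]; simp
      _ ≤ _ := mul_le_mul' (ENNReal.sum_le_tsum s) (ENNReal.sum_le_tsum s)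
  have h2 : Tendsto (fun s : Finset ι => (∑ i ∈ s, u i * v i) ^ 2) atTop
      (𝓝 ((∑' i, u i * v i) ^ 2)) :=
    ((ENNReal.continuous_pow 2).tendsto _).comp ENNReal.summable.hasSum
  exact le_of_tendsto h2 (Eventually.of_forall h)

theorem conv_sq_le (a ξ : Gsu A → ℂ) (L : ℝ≥0∞)
    (hx : ∀ z, ∑' η : {η : Gsu A // η.x = z}, ‖a η.1‖ₑ ≤ L)
    (hy : ∀ z, ∑' η : {η : Gsu A // η.y = z}, ‖a η.1‖ₑ ≤ L) :
    ∑' γ, ‖conv a ξ γ‖ₑ ^ 2 ≤ L ^ 2 * ∑' γ, ‖ξ γ‖ₑ ^ 2 := by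
  have h1 : ∀ γ, ‖conv a ξ γ‖ₑ ^ 2 ≤
      L * ∑' η : {η : Gsu A // η.x = γ.x}, ‖a η.1‖ₑ * ‖ξ (mul (inv η.1) γ η.2)‖ₑ ^ 2 := by
    intro γ
    have h2 : ‖conv a ξ γ‖ₑ ≤
        ∑' η : {η : Gsu A // η.x = γ.x}, ‖a η.1‖ₑ * ‖ξ (mul (inv η.1) γ η.2)‖ₑ := by
      refine enorm_tsum_le_tsum_enorm.trans (le_of_eq ?_)
      simp only [enorm_mul]
    calc ‖conv a ξ γ‖ₑ ^ 2 ≤ _ := by gcongr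
      _ ≤ _ := tsum_mul_sq_le _ _
      _ ≤ _ := by gcongr; exact hx _
  calc ∑' γ, ‖conv a ξ γ‖ₑ ^ 2
      ≤ ∑' γ : Gsu A, L * ∑' η : {η : Gsu A // η.x = γ.x},
          ‖a η.1‖ₑ * ‖ξ (mul (inv η.1) γ η.2)‖ₑ ^ 2 := ENNReal.tsum_le_tsum h1
    _ = L * ∑' z : (Σ γ : Gsu A, {η : Gsu A // η.x = γ.x}),
          ‖a z.2.1‖ₑ * ‖ξ (mul (inv z.2.1) z.1 z.2.2)‖ₑ ^ 2 := by
        rw [ENNReal.tsum_mul_left, ENNReal.tsum_sigma']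
    _ = L * ∑' z : (Σ δ : Gsu A, {η : Gsu A // η.y = δ.x}), ‖a z.2.1‖ₑ * ‖ξ z.1‖ₑ ^ 2 := by
        rw [← (reindex A).tsum_eq]; rfl
    _ = L * ∑' δ : Gsu A, (∑' η : {η : Gsu A // η.y = δ.x}, ‖a η.1‖ₑ) * ‖ξ δ‖ₑ ^ 2 := by
        rw [ENNReal.tsum_sigma']; simp only [ENNReal.tsum_mul_right]
    _ ≤ L * ∑' δ : Gsu A, L * ‖ξ δ‖ₑ ^ 2 := by
        gcongr; exact hy _
    _ = L ^ 2 * ∑' γ, ‖ξ γ‖ₑ ^ 2 := by rw [ENNReal.tsum_mul_left, ← mul_assoc, pow_two]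

end Gsu

/-- The Hilbert space `ℓ²(G_A^{s,u} ⋊ ℤ²)`, the direct sum over `x ∈ X_A` of the Hilbert spaces
`ℓ²(s⁻¹(x))` that carry the left regular representations of the groupoid. -/
abbrev L2 (A : Matrix (Fin N) (Fin N) ℤ) : Type := lp (fun _ : Gsu A => ℂ) 2

theorem memℓp_two_iff {ι : Type} (ξ : ι → ℂ) :
    Memℓp ξ 2 ↔ ∑' i, ‖ξ i‖ₑ ^ 2 ≠ ⊤ := by
  rw [memℓp_gen_iff (by norm_num)]
  have h : ∀ i, ‖ξ i‖ₑ ^ 2 = ENNReal.ofReal (‖ξ i‖ ^ (2 : ℝ≥0∞).toReal) := fun i => by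
    rw [← ofReal_norm, ← ENNReal.ofReal_pow (norm_nonneg _)]; simp
  simp only [h]
  constructor
  · intro hs
    exact hs.tsum_ofReal_ne_top
  · intro hs
    have := ENNReal.summable_toReal hs
    simpa [ENNReal.toReal_ofReal, sq_nonneg] using this

theorem tsum_enorm_sq {ι : Type} (ξ : lp (fun _ : ι => ℂ) 2) :
    ∑' i, ‖ξ i‖ₑ ^ 2 = ENNReal.ofReal (‖ξ‖ ^ 2) := by
  have h1 := lp.norm_rpow_eq_tsum (p := 2) (by norm_num) ξ
  have hs := (memℓp_gen_iff (p := 2) (by norm_num)).mp (lp.memℓp ξ)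
  simp only [ENNReal.toReal_ofNat, Real.rpow_ofNat] at h1 hs
  rw [h1, ENNReal.ofReal_tsum_of_nonneg (fun _ => by positivity) hs]
  refine tsum_congr fun i => ?_
  rw [← ofReal_norm, ← ENNReal.ofReal_pow (norm_nonneg _)]

theorem memℓp_conv (a : C_c(Gsu A, ℂ)) (ξ : L2 A) : Memℓp (Gsu.conv a ξ) 2 := by
  obtain ⟨L, hL, hx, hy⟩ := Gsu.exists_fibre_bound a
  rw [memℓp_two_iff]
  refine ne_top_of_le_ne_top ?_ (Gsu.conv_sq_le a ξ L hx hy)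
  rw [tsum_enorm_sq]
  exact ENNReal.mul_ne_top (ENNReal.pow_ne_top hL) ENNReal.ofReal_ne_top

theorem summable_conv (a : C_c(Gsu A, ℂ)) (ξ : L2 A) (γ : Gsu A) :
    Summable fun η : {η : Gsu A // η.x = γ.x} =>
      a η.1 * ξ (Gsu.mul (Gsu.inv η.1) γ η.2) := by
  obtain ⟨L, hL, hx, hy⟩ := Gsu.exists_fibre_bound a
  have h1 : Summable fun η : {η : Gsu A // η.x = γ.x} => ‖a η.1‖ := by
    have := ENNReal.summable_toReal (ne_top_of_le_ne_top hL (hx γ.x))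
    simpa using this
  refine Summable.of_norm_bounded (h1.mul_right ‖ξ‖) fun η => ?_
  rw [norm_mul]
  exact mul_le_mul_of_nonneg_left (lp.norm_apply_le_norm (by norm_num) ξ _) (norm_nonneg _)

/-- The left regular representation: `leftReg a` is the bounded operator `ξ ↦ a * ξ` on
`ℓ²(G_A^{s,u} ⋊ ℤ²)`, for `a ∈ C_c(G_A^{s,u} ⋊ ℤ²)`. -/
def leftReg (a : C_c(Gsu A, ℂ)) : L2 A →L[ℂ] L2 A :=
  LinearMap.mkContinuousOfExistsBound
    { toFun := fun ξ => ⟨Gsu.conv a ξ, memℓp_conv a ξ⟩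
      map_add' := fun ξ ζ => by
        ext γ
        simp only [Gsu.conv, lp.coeFn_add, Pi.add_apply, mul_add]
        exact (summable_conv a ξ γ).tsum_add (summable_conv a ζ γ)
      map_smul' := fun c ξ => by
        ext γ
        simp only [Gsu.conv, lp.coeFn_smul, Pi.smul_apply, smul_eq_mul, RingHom.id_apply]
        rw [← tsum_mul_left]
        exact tsum_congr fun η => by ring }
    (by
      obtain ⟨L, hL, hx, hy⟩ := Gsu.exists_fibre_bound a
      refine ⟨L.toReal, fun ξ => ?_⟩
      have h := Gsu.conv_sq_le a ξ L hx hy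
      have e := tsum_enorm_sq (⟨Gsu.conv a ξ, memℓp_conv a ξ⟩ : L2 A)
      have e' : ∑' γ, ‖Gsu.conv a ξ γ‖ₑ ^ 2 =
        ENNReal.ofReal (‖(⟨Gsu.conv a ξ, memℓp_conv a ξ⟩ : L2 A)‖ ^ 2) := e
      rw [e', tsum_enorm_sq, ← ENNReal.ofReal_toReal hL,
        ← ENNReal.ofReal_pow ENNReal.toReal_nonneg, ← ENNReal.ofReal_mul (by positivity),
        ENNReal.ofReal_le_ofReal_iff (by positivity), ← mul_pow] at h
      exact (pow_le_pow_iff_left₀ (norm_nonneg _) (by positivity) two_ne_zero).mp h)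

theorem leftReg_apply (a : C_c(Gsu A, ℂ)) (ξ : L2 A) (γ : Gsu A) :
    leftReg a ξ γ = Gsu.conv a ξ γ := rfl

/-- The extended Ruelle algebra `R̃_A = C*(G_A^{s,u} ⋊ ℤ²)`, as the reduced groupoid C*-algebra:
the C*-algebra of operators on `ℓ²(G_A^{s,u} ⋊ ℤ²)` generated by the image of
`C_c(G_A^{s,u} ⋊ ℤ²)` under the left regular representation (this image is a `*`-algebra, so that
the generated C*-algebra is its norm closure). The norm of the operator of `a` is the reduced
C*-norm of `a`, the supremum over `x ∈ X_A` of its norms on `ℓ²(s⁻¹(x))`. -/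
def extRuelle (A : Matrix (Fin N) (Fin N) ℤ) : NonUnitalStarSubalgebra ℂ (L2 A →L[ℂ] L2 A) :=
  (NonUnitalStarAlgebra.adjoin ℂ (Set.range (leftReg (A := A)))).topologicalClosure

theorem leftReg_mem (a : C_c(Gsu A, ℂ)) : leftReg a ∈ extRuelle A :=
  NonUnitalStarSubalgebra.le_topologicalClosure _
    (NonUnitalStarAlgebra.subset_adjoin ℂ _ ⟨a, rfl⟩)

/-! ### The subalgebra `C(X_A)` -/

namespace Gsu

/-- The set of units `(x, 0, 0, x)`. -/
def units (A : Matrix (Fin N) (Fin N) ℤ) : Set (Gsu A) := {g | g.x = g.y ∧ g.p = 0 ∧ g.q = 0}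

theorem units_eq_box : units A = box A 0 0 0 0 := by
  ext g
  constructor
  · rintro ⟨e, hp, hq⟩
    refine ⟨hp, hq, fun i _ => ?_, fun i _ => ?_⟩ <;> simp [shiftZ, hp, hq, e]
  · rintro ⟨hp, hq, hs, hu⟩
    refine ⟨Subtype.ext (funext fun i => ?_), hp, hq⟩
    rcases le_total 0 i with h | h
    · simpa [shiftZ, hp] using hs i (by simpa using h)
    · simpa [shiftZ, hq] using hu i (by simpa using h)

theorem isClopen_units : IsClopen (units A) := by
  constructor
  · exact (isClosed_eq continuous_x continuous_y).inter
      ((isClosed_eq continuous_p continuous_const).inter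
        (isClosed_eq continuous_q continuous_const))
  · rw [units_eq_box]; exact isOpen_box _ _ _ _

theorem continuous_diagS : Continuous fun x : ShiftSpace A => (unit x).toProd.1 := by
  refine ⟨fun U hU => ?_⟩
  obtain ⟨V, hV, hUV⟩ := isOpen_indLim.mp (show IsOpen[indLim (StableRel A) (levelS A)] U from hU) 0
  have hd : Continuous fun x : ShiftSpace A => (x, x) := continuous_id.prodMk continuous_id
  have e : ∀ x : ShiftSpace A, (unit x).toProd.1.1 = (x, x) := fun x => by
    simp [toProd, unit, shiftZ_zero]
  convert hV.preimage hd using 1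
  ext x
  refine (hUV (unit x).toProd.1 (by rw [e]; exact fun _ _ => rfl)).trans ?_
  rw [e]; rfl

theorem continuous_diagU : Continuous fun x : ShiftSpace A => (unit x).toProd.2.1 := by
  refine ⟨fun U hU => ?_⟩
  obtain ⟨V, hV, hUV⟩ :=
    isOpen_indLim.mp (show IsOpen[indLim (UnstableRel A) (levelU A)] U from hU) 0
  have hd : Continuous fun x : ShiftSpace A => (x, x) := continuous_id.prodMk continuous_id
  have e : ∀ x : ShiftSpace A, (unit x).toProd.2.1.1 = (x, x) := fun x => by
    simp [toProd, unit, shiftZ_zero]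
  convert hV.preimage hd using 1
  ext x
  refine (hUV (unit x).toProd.2.1 (by rw [e]; exact fun _ _ => rfl)).trans ?_
  rw [e]; rfl

theorem continuous_unit : Continuous (unit : ShiftSpace A → Gsu A) :=
  continuous_induced_rng.mpr <|
    continuous_diagS.prodMk (continuous_diagU.prodMk (continuous_const.prodMk continuous_const))

/-- The topology of `G_A^{s,u} ⋊ ℤ²` is Hausdorff. -/
instance instT2Gsu : T2Space (Gsu A) :=
  T2Space.of_injective_continuous (f := fun g : Gsu A => (g.x, g.p, g.q, g.y))
    (fun g h e => by
      simp only [Prod.mk.injEq] at e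
      exact Gsu.ext e.1 e.2.1 e.2.2.1 e.2.2.2)
    (continuous_x.prodMk (continuous_p.prodMk (continuous_q.prodMk continuous_y)))

theorem isCompact_units : IsCompact (units A) := by
  have : units A = Set.range (unit : ShiftSpace A → Gsu A) := by
    ext g
    constructor
    · rintro ⟨e, hp, hq⟩
      exact ⟨g.x, Gsu.ext rfl hp.symm hq.symm e⟩
    · rintro ⟨x, rfl⟩
      exact ⟨rfl, rfl, rfl⟩
  rw [this]
  exact isCompact_range continuous_unit

end Gsu

/-- A continuous function `h` on `X_A` as an element of `C_c(G_A^{s,u} ⋊ ℤ²)`: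
`(x, p, q, y) ↦ h x` if `x = y` and `p = q = 0`, and `0` otherwise. -/
def unitFun (h : C(ShiftSpace A, ℂ)) : C_c(Gsu A, ℂ) where
  toFun := (Gsu.units A).indicator fun g => h g.x
  continuous_toFun := (h.continuous.comp Gsu.continuous_x).indicator
    (fun g hg => by rw [Gsu.isClopen_units.frontier_eq] at hg; exact hg.elim)
  hasCompactSupport' := HasCompactSupport.intro Gsu.isCompact_units
    fun g hg => Set.indicator_of_notMem hg _

/-- The subalgebra `C(X_A)` of `R̃_A`. -/
def diagonal (A : Matrix (Fin N) (Fin N) ℤ) : Set (extRuelle A) :=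
  Set.range fun h : C(ShiftSpace A, ℂ) => (⟨leftReg (unitFun h), leftReg_mem _⟩ : extRuelle A)

/-! ### Gauge actions with potentials -/

/-- `fⁿ x = ∑_{i=0}^{n-1} f (σⁱ x)` for `n ≥ 1`, `f⁰ = 0`, and `fⁿ x = -∑_{i=n}^{-1} f (σⁱ x)`
for `n ≤ -1`: at most one of the two sums below is non-empty. -/
def birkhoff (f : C(ShiftSpace A, ℤ)) (n : ℤ) (x : ShiftSpace A) : ℤ :=
  ∑ i ∈ Finset.Ico 0 n, f (shiftZ i x) - ∑ i ∈ Finset.Ico n 0, f (shiftZ i x)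

theorem birkhoff_succ (f : C(ShiftSpace A, ℤ)) (n : ℤ) (x : ShiftSpace A) :
    birkhoff f (n + 1) x = birkhoff f n x + f (shiftZ n x) := by
  unfold birkhoff
  rcases le_or_gt 0 n with h | h
  · have h1 : Finset.Ico 0 (n + 1) = insert n (Finset.Ico 0 n) := by
      ext i; simp only [Finset.mem_Ico, Finset.mem_insert]; omega
    rw [h1, Finset.sum_insert (by simp), Finset.Ico_eq_empty (by omega : ¬ n + 1 < 0),
      Finset.Ico_eq_empty (by omega : ¬ n < 0)]
    simp only [Finset.sum_empty]; ring
  · have h1 : Finset.Ico n 0 = insert n (Finset.Ico (n + 1) 0) := by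
      ext i; simp only [Finset.mem_Ico, Finset.mem_insert]; omega
    rw [h1, Finset.sum_insert (by simp), Finset.Ico_eq_empty (by omega : ¬ 0 < n + 1),
      Finset.Ico_eq_empty (by omega : ¬ 0 < n)]
    simp only [Finset.sum_empty]; ring

theorem continuous_birkhoff (f : C(ShiftSpace A, ℤ)) (n : ℤ) : Continuous (birkhoff f n) := by
  unfold birkhoff
  exact (continuous_finsetSum _ fun i _ => f.continuous.comp (continuous_shiftZ i)).sub
    (continuous_finsetSum _ fun i _ => f.continuous.comp (continuous_shiftZ i))

/-- `f̃⁺ (x, p, q, y) = lim_{n → ∞} (f^{n+p} (σ x) - fⁿ (σ y))`. -/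
def cocPlus (f : C(ShiftSpace A, ℤ)) (g : Gsu A) : ℤ :=
  limUnder atTop fun n : ℤ => birkhoff f (n + g.p) (shift g.x) - birkhoff f n (shift g.y)

/-- `f̃⁻ (x, p, q, y) = lim_{n → -∞} (f^{n+q} x - fⁿ y)`. -/
def cocMinus (f : C(ShiftSpace A, ℤ)) (g : Gsu A) : ℤ :=
  limUnder atBot fun n : ℤ => birkhoff f (n + g.q) g.x - birkhoff f n g.y

/-- A continuous integer-valued function depends on finitely many coordinates. -/
theorem exists_window (f : C(ShiftSpace A, ℤ)) :
    ∃ w : ℕ, ∀ x y : ShiftSpace A, (∀ i ∈ Set.Icc (-(w : ℤ)) w, x.1 i = y.1 i) → f x = f y := by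
  by_contra! hcon
  let T : ℕ → Set (ShiftSpace A × ShiftSpace A) := fun w =>
    {z | ∀ i ∈ Set.Icc (-(w : ℤ)) w, z.1.1 i = z.2.1 i} ∩ {z | f z.1 ≠ f z.2}
  have hcl1 : IsClosed {z : ShiftSpace A × ShiftSpace A | f z.1 ≠ f z.2} :=
    (isClosed_discrete {w : ℤ × ℤ | w.1 ≠ w.2}).preimage
      ((f.continuous.comp continuous_fst).prodMk (f.continuous.comp continuous_snd))
  have hcl : ∀ w, IsClosed (T w) := by
    intro w
    refine IsClosed.inter ?_ hcl1
    have : {z : ShiftSpace A × ShiftSpace A | ∀ i ∈ Set.Icc (-(w : ℤ)) w, z.1.1 i = z.2.1 i}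
        = ⋂ i ∈ Set.Icc (-(w : ℤ)) w, {z | z.1.1 i = z.2.1 i} := by ext z; simp
    rw [this]
    exact isClosed_biInter fun i _ => isClosed_eq
      (((continuous_apply i).comp continuous_subtype_val).comp continuous_fst)
      (((continuous_apply i).comp continuous_subtype_val).comp continuous_snd)
  obtain ⟨z, hz⟩ := IsCompact.nonempty_iInter_of_sequence_nonempty_isCompact_isClosed T
    (fun w z hz => ⟨fun i hi => hz.1 i ⟨by push_cast; have := hi.1; omega,
      by push_cast; have := hi.2; omega⟩, hz.2⟩)
    (fun w => by
      obtain ⟨x, y, h1, h2⟩ := hcon w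
      exact ⟨(x, y), h1, h2⟩)
    (hcl 0).isCompact hcl
  rw [Set.mem_iInter] at hz
  refine (hz 0).2 (congrArg f (Subtype.ext (funext fun i => ?_)))
  exact (hz i.natAbs).1 i ⟨by omega, by omega⟩

theorem cocPlus_spec (f : C(ShiftSpace A, ℤ)) (n m : ℕ) :
    ∃ K : ℤ, ∀ (p q : ℤ), ∀ g ∈ Gsu.box A p q n m,
      (∀ k ≥ K, birkhoff f (k + g.p) (shift g.x) - birkhoff f k (shift g.y) =
        birkhoff f (K + p) (shift g.x) - birkhoff f K (shift g.y)) := by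
  obtain ⟨w, hw⟩ := exists_window f
  refine ⟨n + w, fun p q g hg k hk => ?_⟩
  obtain ⟨rfl, rfl, hs, -⟩ := hg
  induction k, hk using Int.leInduction with
  | base => rfl
  | succ k hk ih =>
    rw [← ih, show k + 1 + g.p = k + g.p + 1 by ring, birkhoff_succ, birkhoff_succ]
    have : f (shiftZ (k + g.p) (shift g.x)) = f (shiftZ k (shift g.y)) := by
      refine hw _ _ fun i hi => ?_
      have h1 := hs (i + k + 1) (by have := hi.1; omega)
      simp only [shift, shiftZ] at h1 ⊢
      rw [← h1]; ring_nf
    rw [this]; ring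

theorem cocMinus_spec (f : C(ShiftSpace A, ℤ)) (n m : ℕ) :
    ∃ K : ℤ, ∀ (p q : ℤ), ∀ g ∈ Gsu.box A p q n m,
      (∀ k ≤ K, birkhoff f (k + g.q) g.x - birkhoff f k g.y =
        birkhoff f (K + q) g.x - birkhoff f K g.y) := by
  obtain ⟨w, hw⟩ := exists_window f
  refine ⟨-m - w, fun p q g hg k hk => ?_⟩
  obtain ⟨rfl, rfl, -, hu⟩ := hg
  induction k, hk using Int.leInductionDown with
  | base => rfl
  | pred k hk ih =>
    have e1 := birkhoff_succ f (k - 1 + g.q) g.x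
    have e2 := birkhoff_succ f (k - 1) g.y
    rw [show k - 1 + g.q + 1 = k + g.q by ring] at e1
    rw [sub_add_cancel] at e2
    have : f (shiftZ (k - 1 + g.q) g.x) = f (shiftZ (k - 1) g.y) := by
      refine hw _ _ fun i hi => ?_
      have h1 := hu (i + (k - 1)) (by have := hi.2; omega)
      simp only [shiftZ] at h1 ⊢
      rw [← h1]; ring_nf
    rw [← ih, e1, e2, this]; ring

theorem tendsto_cocPlus (f : C(ShiftSpace A, ℤ)) (g : Gsu A) :
    Tendsto (fun n : ℤ => birkhoff f (n + g.p) (shift g.x) - birkhoff f n (shift g.y)) atTop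
      (𝓝 (cocPlus f g)) := by
  obtain ⟨n, m, hg⟩ := g.exists_mem_box
  obtain ⟨K, hK⟩ := cocPlus_spec f n m
  refine tendsto_nhds_limUnder
    ⟨birkhoff f (K + g.p) (shift g.x) - birkhoff f K (shift g.y), tendsto_const_nhds.congr' ?_⟩
  filter_upwards [eventually_ge_atTop K] with k hk using (hK _ _ g hg k hk).symm

theorem tendsto_cocMinus (f : C(ShiftSpace A, ℤ)) (g : Gsu A) :
    Tendsto (fun n : ℤ => birkhoff f (n + g.q) g.x - birkhoff f n g.y) atBot
      (𝓝 (cocMinus f g)) := by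
  obtain ⟨n, m, hg⟩ := g.exists_mem_box
  obtain ⟨K, hK⟩ := cocMinus_spec f n m
  refine tendsto_nhds_limUnder
    ⟨birkhoff f (K + g.q) g.x - birkhoff f K g.y, tendsto_const_nhds.congr' ?_⟩
  filter_upwards [eventually_le_atBot K] with k hk using (hK _ _ g hg k hk).symm

theorem continuous_cocPlus (f : C(ShiftSpace A, ℤ)) : Continuous (cocPlus f) := by
  refine continuous_iff_continuousAt.mpr fun g => ?_
  obtain ⟨n, m, hg⟩ := g.exists_mem_box
  obtain ⟨K, hK⟩ := cocPlus_spec f n m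
  have hc : Continuous fun h : Gsu A =>
      birkhoff f (K + g.p) (shift h.x) - birkhoff f K (shift h.y) :=
    ((continuous_birkhoff f _).comp ((continuous_shiftZ 1).comp Gsu.continuous_x)).sub
      ((continuous_birkhoff f _).comp ((continuous_shiftZ 1).comp Gsu.continuous_y))
  refine hc.continuousAt.congr ?_
  filter_upwards [(Gsu.isOpen_box g.p g.q n m).mem_nhds hg] with h hh
  refine tendsto_nhds_unique (tendsto_const_nhds.congr' ?_) (tendsto_cocPlus f h)
  filter_upwards [eventually_ge_atTop K] with k hk using (hK _ _ h hh k hk).symm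

theorem continuous_cocMinus (f : C(ShiftSpace A, ℤ)) : Continuous (cocMinus f) := by
  refine continuous_iff_continuousAt.mpr fun g => ?_
  obtain ⟨n, m, hg⟩ := g.exists_mem_box
  obtain ⟨K, hK⟩ := cocMinus_spec f n m
  have hc : Continuous fun h : Gsu A => birkhoff f (K + g.q) h.x - birkhoff f K h.y :=
    ((continuous_birkhoff f _).comp Gsu.continuous_x).sub
      ((continuous_birkhoff f _).comp Gsu.continuous_y)
  refine hc.continuousAt.congr ?_
  filter_upwards [(Gsu.isOpen_box g.p g.q n m).mem_nhds hg] with h hh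
  refine tendsto_nhds_unique (tendsto_const_nhds.congr' ?_) (tendsto_cocMinus f h)
  filter_upwards [eventually_le_atBot K] with k hk using (hK _ _ h hh k hk).symm

theorem cocPlus_mul (f : C(ShiftSpace A, ℤ)) (g h : Gsu A) (e : g.y = h.x) :
    cocPlus f (g.mul h e) = cocPlus f g + cocPlus f h := by
  have h1 := (tendsto_cocPlus f g).comp (tendsto_atTop_add_const_right atTop h.p tendsto_id)
  refine tendsto_nhds_unique (tendsto_cocPlus f (g.mul h e))
    ((h1.add (tendsto_cocPlus f h)).congr fun n => ?_)
  simp only [Function.comp, id, Gsu.mul, e]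
  rw [show n + h.p + g.p = n + (g.p + h.p) by ring]; ring

theorem cocMinus_mul (f : C(ShiftSpace A, ℤ)) (g h : Gsu A) (e : g.y = h.x) :
    cocMinus f (g.mul h e) = cocMinus f g + cocMinus f h := by
  have h1 := (tendsto_cocMinus f g).comp (tendsto_atBot_add_const_right atBot h.q tendsto_id)
  refine tendsto_nhds_unique (tendsto_cocMinus f (g.mul h e))
    ((h1.add (tendsto_cocMinus f h)).congr fun n => ?_)
  simp only [Function.comp, id, Gsu.mul, e]
  rw [show n + h.q + g.q = n + (g.q + h.q) by ring]; ring

/-- The function `U_{(r,s)}(f̃) (γ) = exp (2 π i (f̃⁺(γ) s + f̃⁻(γ) r))` on `G_A^{s,u} ⋊ ℤ²`, for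
`(r, s) ∈ 𝕋² = (ℝ / ℤ)²`; here `AddCircle.toCircle t = exp (2 π i t)`. -/
def phase (f : C(ShiftSpace A, ℤ)) (r s : UnitAddCircle) (γ : Gsu A) : Circle :=
  AddCircle.toCircle (cocPlus f γ • s + cocMinus f γ • r)

theorem continuous_phase (f : C(ShiftSpace A, ℤ)) (r s : UnitAddCircle) :
    Continuous (phase f r s) := by
  have h : Continuous fun z : ℤ × ℤ => (AddCircle.toCircle (z.1 • s + z.2 • r) : Circle) :=
    continuous_of_discreteTopology
  exact h.comp ((continuous_cocPlus f).prodMk (continuous_cocMinus f))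

theorem phase_mul (f : C(ShiftSpace A, ℤ)) (r s : UnitAddCircle) (g h : Gsu A) (e : g.y = h.x) :
    phase f r s (g.mul h e) = phase f r s g * phase f r s h := by
  unfold phase
  rw [cocPlus_mul, cocMinus_mul, ← AddCircle.toCircle_add]
  congr 1
  simp only [add_smul]; abel

theorem memℓp_circle_mul (u : Gsu A → Circle) (ξ : L2 A) :
    Memℓp (fun γ => (u γ : ℂ) * ξ γ) 2 := by
  rw [memℓp_two_iff]
  have := (memℓp_two_iff _).mp (lp.memℓp ξ)
  have e : ∀ γ, ‖(u γ : ℂ) * ξ γ‖ₑ = ‖ξ γ‖ₑ := fun γ => by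
    rw [← ofReal_norm, ← ofReal_norm, norm_mul, Circle.norm_coe, one_mul]
  simpa only [e] using this

/-- The unitary operator of multiplication by a function `u` with values in the unit circle. -/
def mulUnitary (u : Gsu A → Circle) : L2 A ≃ₗᵢ[ℂ] L2 A where
  toFun ξ := ⟨fun γ => (u γ : ℂ) * ξ γ, memℓp_circle_mul u ξ⟩
  invFun ξ := ⟨fun γ => ((u γ)⁻¹ : Circle) * ξ γ, memℓp_circle_mul (fun γ => (u γ)⁻¹) ξ⟩
  map_add' ξ ζ := by
    ext γ
    exact mul_add _ _ _
  map_smul' c ξ := by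
    ext γ
    exact mul_left_comm _ _ _
  left_inv ξ := by
    ext γ
    show (((u γ)⁻¹ : Circle) : ℂ) * ((u γ : ℂ) * ξ γ) = ξ γ
    rw [← mul_assoc, ← Circle.coe_mul, inv_mul_cancel, Circle.coe_one, one_mul]
  right_inv ξ := by
    ext γ
    show (u γ : ℂ) * ((((u γ)⁻¹ : Circle) : ℂ) * ξ γ) = ξ γ
    rw [← mul_assoc, ← Circle.coe_mul, mul_inv_cancel, Circle.coe_one, one_mul]
  norm_map' ξ := by
    have h1 := lp.norm_rpow_eq_tsum (p := 2) (by norm_num) ξ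
    have h2 := lp.norm_rpow_eq_tsum (p := 2) (by norm_num)
      (⟨fun γ => (u γ : ℂ) * ξ γ, memℓp_circle_mul u ξ⟩ : L2 A)
    have e : ∀ γ, ‖(u γ : ℂ) * ξ γ‖ = ‖ξ γ‖ := fun γ => by
      rw [norm_mul, Circle.norm_coe, one_mul]
    simp only [e] at h2
    rw [← h1] at h2
    simp only [ENNReal.toReal_ofNat, Real.rpow_ofNat] at h2
    exact (pow_left_inj₀ (norm_nonneg _) (norm_nonneg _) two_ne_zero).mp h2

theorem mulUnitary_apply (u : Gsu A → Circle) (ξ : L2 A) (γ : Gsu A) :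
    mulUnitary u ξ γ = (u γ : ℂ) * ξ γ := rfl

theorem mulUnitary_symm_apply (u : Gsu A → Circle) (ξ : L2 A) (γ : Gsu A) :
    (mulUnitary u).symm ξ γ = ((u γ)⁻¹ : Circle) * ξ γ := rfl

/-- `U_{(r,s)}(f̃)` as a unitary operator on `ℓ²(G_A^{s,u} ⋊ ℤ²)`:
`[U_{(r,s)}(f̃) ξ](γ) = exp (2 π i (f̃⁺(γ) s + f̃⁻(γ) r)) ξ(γ)`. -/
def gaugeUnitary (f : C(ShiftSpace A, ℤ)) (r s : UnitAddCircle) : unitary (L2 A →L[ℂ] L2 A) :=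
  Unitary.linearIsometryEquiv.symm (mulUnitary (phase f r s))

/-- `Ad (U_{(r,s)}(f̃))` on all bounded operators: `T ↦ U_{(r,s)}(f̃) T U_{(r,s)}(f̃)*`. -/
def gaugeAd (f : C(ShiftSpace A, ℤ)) (r s : UnitAddCircle) :
    (L2 A →L[ℂ] L2 A) ≃⋆ₐ[ℂ] (L2 A →L[ℂ] L2 A) :=
  Unitary.conjStarAlgAut ℂ _ (gaugeUnitary f r s)

theorem gaugeAd_apply_apply (f : C(ShiftSpace A, ℤ)) (r s : UnitAddCircle) (T : L2 A →L[ℂ] L2 A)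
    (ξ : L2 A) : gaugeAd f r s T ξ =
      mulUnitary (phase f r s) (T ((mulUnitary (phase f r s)).symm ξ)) := by
  unfold gaugeAd gaugeUnitary
  rw [Unitary.conjStarAlgAut_symm_unitaryLinearIsometryEquiv]
  rfl

/-- The pointwise product of `U_{(r,s)}(f̃)` and `a ∈ C_c(G_A^{s,u} ⋊ ℤ²)`. -/
def phaseMul (f : C(ShiftSpace A, ℤ)) (r s : UnitAddCircle) (a : C_c(Gsu A, ℂ)) :
    C_c(Gsu A, ℂ) where
  toFun γ := (phase f r s γ : ℂ) * a γ
  continuous_toFun := ((by fun_prop : Continuous fun c : Circle => (c : ℂ)).comp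
    (continuous_phase f r s)).mul a.continuous
  hasCompactSupport' := a.hasCompactSupport.mul_left

theorem gaugeAd_leftReg (f : C(ShiftSpace A, ℤ)) (r s : UnitAddCircle) (a : C_c(Gsu A, ℂ)) :
    gaugeAd f r s (leftReg a) = leftReg (phaseMul f r s a) := by
  ext ξ γ
  rw [gaugeAd_apply_apply, mulUnitary_apply, leftReg_apply, leftReg_apply]
  unfold Gsu.conv
  rw [← tsum_mul_left]
  refine tsum_congr fun η => ?_
  rw [mulUnitary_symm_apply]
  have hγ : phase f r s γ = phase f r s η.1 * phase f r s (Gsu.mul (Gsu.inv η.1) γ η.2) := by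
    rw [← phase_mul f r s η.1 (Gsu.mul (Gsu.inv η.1) γ η.2) rfl]
    congr 1
    apply Gsu.ext <;> simp [Gsu.mul, Gsu.inv, η.2]
  have hv : phase f r s γ * (phase f r s (Gsu.mul (Gsu.inv η.1) γ η.2))⁻¹ = phase f r s η.1 := by
    rw [hγ, mul_inv_cancel_right]
  have hc := congrArg (fun c : Circle => (c : ℂ)) hv
  simp only [Circle.coe_mul] at hc
  show (phase f r s γ : ℂ) * (a η.1 * (_ * _)) = ((phase f r s η.1 : ℂ) * a η.1) * _
  rw [← hc]
  ring

theorem continuous_gaugeAd (f : C(ShiftSpace A, ℤ)) (r s : UnitAddCircle) :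
    Continuous (gaugeAd f r s) := by
  show Continuous fun T : L2 A →L[ℂ] L2 A =>
    (gaugeUnitary f r s : L2 A →L[ℂ] L2 A) * T * (star (gaugeUnitary f r s) : L2 A →L[ℂ] L2 A)
  fun_prop

theorem gaugeAd_mem (f : C(ShiftSpace A, ℤ)) (r s : UnitAddCircle) {T : L2 A →L[ℂ] L2 A}
    (hT : T ∈ extRuelle A) : gaugeAd f r s T ∈ extRuelle A := by
  have h : extRuelle A ≤ (extRuelle A).comap (gaugeAd f r s) := by
    refine NonUnitalStarSubalgebra.topologicalClosure_minimal _ ?_ ?_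
    · refine NonUnitalStarAlgebra.adjoin_le ?_
      rintro _ ⟨a, rfl⟩
      show gaugeAd f r s (leftReg a) ∈ extRuelle A
      rw [gaugeAd_leftReg]
      exact leftReg_mem _
    · exact (NonUnitalStarSubalgebra.isClosed_topologicalClosure _).preimage
        (continuous_gaugeAd f r s)
  exact h hT

theorem gaugeAd_neg (f : C(ShiftSpace A, ℤ)) (r s : UnitAddCircle) (T : L2 A →L[ℂ] L2 A) :
    gaugeAd f (-r) (-s) (gaugeAd f r s T) = T := by
  have hph : ∀ γ, phase f (-r) (-s) γ = (phase f r s γ)⁻¹ := fun γ => by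
    unfold phase
    rw [← AddCircle.toCircle_neg]
    congr 1
    simp only [smul_neg]; abel
  have h1 : ∀ ξ : L2 A, mulUnitary (phase f (-r) (-s)) ξ = (mulUnitary (phase f r s)).symm ξ := by
    intro ξ
    ext γ
    rw [mulUnitary_apply, mulUnitary_symm_apply, hph]
  have h2 : ∀ ξ : L2 A, (mulUnitary (phase f (-r) (-s))).symm ξ = mulUnitary (phase f r s) ξ := by
    intro ξ
    ext γ
    rw [mulUnitary_apply, mulUnitary_symm_apply, hph, inv_inv]
  ext1 ξ
  rw [gaugeAd_apply_apply, gaugeAd_apply_apply, h1, h2]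
  simp

/-- The automorphism `γ^{A,f}_{(r,s)}` of `R̃_A`: the restriction of `Ad (U_{(r,s)}(f̃))`. -/
def gaugeAction (f : C(ShiftSpace A, ℤ)) (r s : UnitAddCircle) :
    extRuelle A ≃⋆ₐ[ℂ] extRuelle A where
  toFun a := ⟨gaugeAd f r s a, gaugeAd_mem f r s a.2⟩
  invFun a := ⟨gaugeAd f (-r) (-s) a, gaugeAd_mem f (-r) (-s) a.2⟩
  left_inv a := Subtype.ext (gaugeAd_neg f r s a)
  right_inv a := Subtype.ext (by
    have h := gaugeAd_neg f (-r) (-s) (a : L2 A →L[ℂ] L2 A)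
    rwa [neg_neg, neg_neg] at h)
  map_mul' a b := Subtype.ext (map_mul (gaugeAd f r s) _ _)
  map_add' a b := Subtype.ext (map_add (gaugeAd f r s) _ _)
  map_star' a := Subtype.ext (map_star (gaugeAd f r s) _)
  map_smul' c a := Subtype.ext (map_smul (gaugeAd f r s) c _)

end MarkovShift

end

noncomputable section

open Filter Topology
open scoped ENNReal CompactlySupported

namespace MarkovShift

variable {N M : ℕ} {A : Matrix (Fin N) (Fin N) ℤ} {B : Matrix (Fin M) (Fin M) ℤ}

/-! ### Shift-commuting continuous maps -/

theorem map_shiftZ {φ : ShiftSpace A → ShiftSpace B} (hφ : ∀ x, φ (shift x) = shift (φ x))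
    (n : ℤ) (x : ShiftSpace A) : φ (shiftZ n x) = shiftZ n (φ x) := by
  induction n with
  | zero => rw [shiftZ_zero, shiftZ_zero]
  | succ n ih =>
    rw [add_comm, ← shiftZ_shiftZ, ← shiftZ_shiftZ, ← ih]
    exact hφ _
  | pred n ih =>
    have h := hφ (shiftZ (-(n : ℤ) - 1) x)
    rw [shift, shiftZ_shiftZ, show (1 : ℤ) + (-n - 1) = -n by ring, ih] at h
    rw [show -(n : ℤ) - 1 = -1 + -n by ring, ← shiftZ_shiftZ (-1) (-n) (φ x), h, shift,
      shiftZ_shiftZ, neg_add_cancel, shiftZ_zero]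
    congr 2; ring

/-- A continuous shift-commuting map is a sliding block code. -/
theorem exists_block_window {φ : ShiftSpace A → ShiftSpace B} (hc : Continuous φ)
    (hφ : ∀ x, φ (shift x) = shift (φ x)) :
    ∃ w : ℕ, ∀ (x y : ShiftSpace A) (k : ℤ),
      (∀ i ∈ Set.Icc (k - w) (k + w), x.1 i = y.1 i) → (φ x).1 k = (φ y).1 k := by
  have hd : Continuous fun j : Fin M => (j.val : ℤ) := continuous_of_discreteTopology
  obtain ⟨w, hw⟩ := exists_window (A := A) ⟨fun x => (((φ x).1 0).val : ℤ),
    hd.comp ((continuous_apply 0).comp (continuous_subtype_val.comp hc))⟩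
  refine ⟨w, fun x y k h => ?_⟩
  have h1 := hw (shiftZ k x) (shiftZ k y) fun i hi =>
    h (i + k) ⟨by have := hi.1; omega, by have := hi.2; omega⟩
  simp only [ContinuousMap.coe_mk, map_shiftZ hφ, Nat.cast_inj] at h1
  simpa [shiftZ] using Fin.ext h1

theorem exists_map_mem_levelS {φ : ShiftSpace A → ShiftSpace B} (hc : Continuous φ)
    (hφ : ∀ x, φ (shift x) = shift (φ x)) :
    ∃ w : ℕ, ∀ n z, z ∈ levelS A n → Prod.map φ φ z ∈ levelS B (n + w) := by
  obtain ⟨w, hw⟩ := exists_block_window hc hφ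
  refine ⟨w, fun n z hz k hk => hw _ _ k fun i hi => hz i ?_⟩
  have := hi.1
  push_cast at hk
  omega

theorem exists_map_mem_levelU {φ : ShiftSpace A → ShiftSpace B} (hc : Continuous φ)
    (hφ : ∀ x, φ (shift x) = shift (φ x)) :
    ∃ w : ℕ, ∀ n z, z ∈ levelU A n → Prod.map φ φ z ∈ levelU B (n + w) := by
  obtain ⟨w, hw⟩ := exists_block_window hc hφ
  refine ⟨w, fun n z hz k hk => hw _ _ k fun i hi => hz i ?_⟩
  have := hi.2
  push_cast at hk
  omega

theorem Stable.map {φ : ShiftSpace A → ShiftSpace B} (hc : Continuous φ)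
    (hφ : ∀ x, φ (shift x) = shift (φ x)) {x y : ShiftSpace A} (h : Stable x y) :
    Stable (φ x) (φ y) := by
  obtain ⟨w, hw⟩ := exists_map_mem_levelS hc hφ
  obtain ⟨n, hn⟩ := stable_iff.mp h
  exact stable_iff.mpr ⟨n + w, hw n (x, y) hn⟩

theorem Unstable.map {φ : ShiftSpace A → ShiftSpace B} (hc : Continuous φ)
    (hφ : ∀ x, φ (shift x) = shift (φ x)) {x y : ShiftSpace A} (h : Unstable x y) :
    Unstable (φ x) (φ y) := by
  obtain ⟨w, hw⟩ := exists_map_mem_levelU hc hφ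
  obtain ⟨n, hn⟩ := unstable_iff.mp h
  exact unstable_iff.mpr ⟨n + w, hw n (x, y) hn⟩

/-- A continuous map of the ambient spaces that shifts the levels by a bounded amount is continuous
for the inductive limit topologies. -/
theorem continuous_indLim_map {Y Z : Type} [TopologicalSpace Y] [TopologicalSpace Z]
    {S : Set Y} {T : Set Z} {E : ℕ → Set Y} {F : ℕ → Set Z} {u : Y → Z} (hu : Continuous u)
    (hST : ∀ z ∈ S, u z ∈ T) {w : ℕ} (hEF : ∀ n, ∀ z ∈ E n, u z ∈ F (n + w)) :
    @Continuous S T (indLim S E) (indLim T F) fun z => ⟨u z, hST z z.2⟩ := by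
  refine @Continuous.mk _ _ (indLim S E) (indLim T F) _ fun U hU => isOpen_indLim.mpr fun n => ?_
  obtain ⟨V, hV, hUV⟩ := isOpen_indLim.mp hU (n + w)
  exact ⟨u ⁻¹' V, hV.preimage hu, fun z hz => hUV ⟨u z, hST z z.2⟩ (hEF n z hz)⟩

/-! ### The induced isomorphism of groupoids -/

namespace Gsu

/-- The groupoid homomorphism `(x, p, q, y) ↦ (φ x, p, q, φ y)`. -/
def map (φ : ShiftSpace A → ShiftSpace B) (hc : Continuous φ)
    (hφ : ∀ x, φ (shift x) = shift (φ x)) (g : Gsu A) : Gsu B where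
  x := φ g.x
  p := g.p
  q := g.q
  y := φ g.y
  stable := by rw [← map_shiftZ hφ]; exact g.stable.map hc hφ
  unstable := by rw [← map_shiftZ hφ]; exact g.unstable.map hc hφ

theorem continuous_map {φ : ShiftSpace A → ShiftSpace B} (hc : Continuous φ)
    (hφ : ∀ x, φ (shift x) = shift (φ x)) : Continuous (map φ hc hφ) := by
  obtain ⟨v, hv⟩ := exists_map_mem_levelS hc hφ
  obtain ⟨w, hw⟩ := exists_map_mem_levelU hc hφ
  let FS : Gs A → Gs B := fun z => ⟨Prod.map φ φ z.1, Stable.map hc hφ z.2⟩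
  have hS : Continuous FS :=
    continuous_indLim_map (S := StableRel A) (T := StableRel B) (hc.prodMap hc)
      (fun _ h => Stable.map hc hφ h) hv
  let FU : Gu A → Gu B := fun z => ⟨Prod.map φ φ z.1, Unstable.map hc hφ z.2⟩
  have hU : Continuous FU :=
    continuous_indLim_map (S := UnstableRel A) (T := UnstableRel B) (hc.prodMap hc)
      (fun _ h => Unstable.map hc hφ h) hw
  refine continuous_induced_rng.mpr <| Continuous.prodMk ?_ <| Continuous.prodMk ?_ <|
    continuous_p.prodMk continuous_q
  · refine (hS.comp continuous_toGs).congr fun g => ?_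
    exact Subtype.ext (Prod.ext (map_shiftZ hφ _ _) rfl)
  · refine (hU.comp continuous_toGu).congr fun g => ?_
    exact Subtype.ext (Prod.ext (map_shiftZ hφ _ _) rfl)

/-- The isomorphism of topological groupoids induced by a topological conjugacy. -/
def congr (φ : ShiftSpace A ≃ₜ ShiftSpace B) (hφ : ∀ x, φ (shift x) = shift (φ x))
    (hφ' : ∀ x, φ.symm (shift x) = shift (φ.symm x)) : Gsu A ≃ₜ Gsu B where
  toFun := map φ φ.continuous hφ
  invFun := map φ.symm φ.symm.continuous hφ'
  left_inv g := by apply Gsu.ext <;> simp [map]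
  right_inv g := by apply Gsu.ext <;> simp [map]
  continuous_toFun := continuous_map _ _
  continuous_invFun := continuous_map _ _

end Gsu

/-! ### The induced isomorphism of the extended Ruelle algebras -/

/-- The unitary `ℓ²(G_A^{s,u} ⋊ ℤ²) → ℓ²(G_B^{s,u} ⋊ ℤ²)` induced by a bijection. -/
def l2Congr (e : Gsu A ≃ Gsu B) : L2 A ≃ₗᵢ[ℂ] L2 B where
  toFun ξ := ⟨fun γ => ξ (e.symm γ), by
    show Memℓp (fun γ => ξ (e.symm γ)) 2
    rw [memℓp_two_iff, e.symm.tsum_eq fun γ => ‖ξ γ‖ₑ ^ 2]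
    exact (memℓp_two_iff _).mp (lp.memℓp ξ)⟩
  invFun ξ := ⟨fun γ => ξ (e γ), by
    show Memℓp (fun γ => ξ (e γ)) 2
    rw [memℓp_two_iff, e.tsum_eq fun γ => ‖ξ γ‖ₑ ^ 2]
    exact (memℓp_two_iff _).mp (lp.memℓp ξ)⟩
  map_add' ξ ζ := rfl
  map_smul' c ξ := rfl
  left_inv ξ := by
    ext γ
    exact congrArg ξ (e.symm_apply_apply γ)
  right_inv ξ := by
    ext γ
    exact congrArg ξ (e.apply_symm_apply γ)
  norm_map' ξ := by
    rw [← pow_left_inj₀ (norm_nonneg _) (norm_nonneg _) two_ne_zero,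
      ← ENNReal.ofReal_eq_ofReal_iff (by positivity) (by positivity), ← tsum_enorm_sq,
      ← tsum_enorm_sq]
    exact e.symm.tsum_eq fun γ => ‖ξ γ‖ₑ ^ 2

section Conjugacy

variable (φ : ShiftSpace A ≃ₜ ShiftSpace B) (hφ : ∀ x, φ (shift x) = shift (φ x))
  (hφ' : ∀ x, φ.symm (shift x) = shift (φ.symm x))

/-- Conjugation by the unitary induced by a topological conjugacy. -/
def conjEquiv : (L2 A →L[ℂ] L2 A) ≃⋆ₐ[ℂ] (L2 B →L[ℂ] L2 B) :=
  (l2Congr (Gsu.congr φ hφ hφ').toEquiv).conjStarAlgEquiv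

theorem conjEquiv_apply_apply (T : L2 A →L[ℂ] L2 A) (ξ : L2 B) (γ : Gsu B) :
    conjEquiv φ hφ hφ' T ξ γ =
      T ((l2Congr (Gsu.congr φ hφ hφ').toEquiv).symm ξ) ((Gsu.congr φ hφ hφ').symm γ) := rfl

/-- The transport of `a ∈ C_c(G_A^{s,u} ⋊ ℤ²)` to `C_c(G_B^{s,u} ⋊ ℤ²)`. -/
def ccMap (a : C_c(Gsu A, ℂ)) : C_c(Gsu B, ℂ) where
  toFun γ := a ((Gsu.congr φ hφ hφ').symm γ)
  continuous_toFun := a.continuous.comp (Gsu.congr φ hφ hφ').symm.continuous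
  hasCompactSupport' := a.hasCompactSupport.comp_homeomorph (Gsu.congr φ hφ hφ').symm

theorem conjEquiv_leftReg (a : C_c(Gsu A, ℂ)) :
    conjEquiv φ hφ hφ' (leftReg a) = leftReg (ccMap φ hφ hφ' a) := by
  ext ξ γ
  rw [conjEquiv_apply_apply, leftReg_apply, leftReg_apply]
  unfold Gsu.conv
  let e := (Gsu.congr φ hφ hφ').symm.toEquiv
  have he : ∀ η : Gsu B, η.x = γ.x ↔ (e η).x = (e γ).x := fun η => φ.symm.injective.eq_iff.symm
  rw [← (e.subtypeEquiv he).tsum_eq]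
  refine tsum_congr fun η => ?_
  show a (e η.1) * ξ (Gsu.congr φ hφ hφ' _) = a (e η.1) * _
  refine congrArg (fun δ => a (e η.1) * ξ δ) ?_
  exact Gsu.ext (φ.apply_symm_apply η.1.y) rfl rfl (φ.apply_symm_apply γ.y)

theorem conjEquiv_mem {T : L2 A →L[ℂ] L2 A} (hT : T ∈ extRuelle A) :
    conjEquiv φ hφ hφ' T ∈ extRuelle B := by
  have h : extRuelle A ≤ (extRuelle B).comap (conjEquiv φ hφ hφ') := by
    refine NonUnitalStarSubalgebra.topologicalClosure_minimal _ ?_ ?_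
    · refine NonUnitalStarAlgebra.adjoin_le ?_
      rintro _ ⟨a, rfl⟩
      show conjEquiv φ hφ hφ' (leftReg a) ∈ extRuelle B
      rw [conjEquiv_leftReg]
      exact leftReg_mem _
    · refine (NonUnitalStarSubalgebra.isClosed_topologicalClosure _).preimage ?_
      exact (l2Congr (Gsu.congr φ hφ hφ').toEquiv).toContinuousLinearEquiv.conjContinuousAlgEquiv
        |>.continuous
  exact h hT

/-- The isomorphism `R̃_A ≅ R̃_B` induced by a topological conjugacy. -/
def extRuelleCongr : extRuelle A ≃⋆ₐ[ℂ] extRuelle B where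
  toFun a := ⟨conjEquiv φ hφ hφ' a, conjEquiv_mem φ hφ hφ' a.2⟩
  invFun a := ⟨(conjEquiv φ hφ hφ').symm a, conjEquiv_mem φ.symm hφ' hφ a.2⟩
  left_inv _ := Subtype.ext ((conjEquiv φ hφ hφ').symm_apply_apply _)
  right_inv _ := Subtype.ext ((conjEquiv φ hφ hφ').apply_symm_apply _)
  map_mul' _ _ := Subtype.ext (map_mul (conjEquiv φ hφ hφ') _ _)
  map_add' _ _ := Subtype.ext (map_add (conjEquiv φ hφ hφ') _ _)
  map_star' _ := Subtype.ext (map_star (conjEquiv φ hφ hφ') _)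
  map_smul' c _ := Subtype.ext (map_smul (conjEquiv φ hφ hφ') c _)

theorem ccMap_unitFun (h : C(ShiftSpace A, ℂ)) :
    ccMap φ hφ hφ' (unitFun h) = unitFun (h.comp (φ.symm : C(ShiftSpace B, ShiftSpace A))) := by
  ext γ
  have hu : (Gsu.congr φ hφ hφ').symm γ ∈ Gsu.units A ↔ γ ∈ Gsu.units B :=
    and_congr_left fun _ => φ.symm.injective.eq_iff
  by_cases hγ : γ ∈ Gsu.units B
  · exact (Set.indicator_of_mem (hu.mpr hγ) fun γ => h γ.x).trans
      (Set.indicator_of_mem hγ fun γ => h (φ.symm γ.x)).symm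
  · exact (Set.indicator_of_notMem (mt hu.mp hγ) fun γ => h γ.x).trans
      (Set.indicator_of_notMem hγ fun γ => h (φ.symm γ.x)).symm

theorem extRuelleCongr_image_diagonal :
    extRuelleCongr φ hφ hφ' '' diagonal A = diagonal B := by
  have key : ∀ h : C(ShiftSpace A, ℂ),
      extRuelleCongr φ hφ hφ' ⟨leftReg (unitFun h), leftReg_mem _⟩ =
        ⟨leftReg (unitFun (h.comp (φ.symm : C(ShiftSpace B, ShiftSpace A)))), leftReg_mem _⟩ :=
    fun h => Subtype.ext <| (conjEquiv_leftReg φ hφ hφ' _).trans <| by rw [ccMap_unitFun]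
  ext T
  constructor
  · rintro ⟨_, ⟨h, rfl⟩, rfl⟩
    exact ⟨_, (key h).symm⟩
  · rintro ⟨h, rfl⟩
    refine ⟨_, ⟨h.comp (φ : C(ShiftSpace A, ShiftSpace B)), rfl⟩, (key _).trans ?_⟩
    congr 3
    ext x
    simp

/-! ### Compatibility with the gauge actions -/

variable {f : C(ShiftSpace A, ℤ)} {g : C(ShiftSpace B, ℤ)}

theorem birkhoff_map {φ : ShiftSpace A → ShiftSpace B} (hφ : ∀ x, φ (shift x) = shift (φ x))
    (hfg : ∀ x, f x = g (φ x)) (n : ℤ) (x : ShiftSpace A) :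
    birkhoff g n (φ x) = birkhoff f n x := by
  simp only [birkhoff, hfg, map_shiftZ hφ]

theorem phase_map {φ : ShiftSpace A → ShiftSpace B} (hc : Continuous φ)
    (hφ : ∀ x, φ (shift x) = shift (φ x)) (hfg : ∀ x, f x = g (φ x)) (r s : UnitAddCircle)
    (γ : Gsu A) : phase g r s (Gsu.map φ hc hφ γ) = phase f r s γ := by
  simp only [phase, cocPlus, cocMinus, Gsu.map, ← hφ, birkhoff_map hφ hfg]

theorem phase_congr_symm (hfg : ∀ x, f x = g (φ x)) (r s : UnitAddCircle) (γ : Gsu B) :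
    phase f r s ((Gsu.congr φ hφ hφ').symm γ) = phase g r s γ :=
  phase_map φ.symm.continuous hφ' (fun x => by rw [hfg, φ.apply_symm_apply]) r s γ

theorem extRuelleCongr_gaugeAction (hfg : ∀ x, f x = g (φ x)) (r s : UnitAddCircle)
    (a : extRuelle A) : extRuelleCongr φ hφ hφ' (gaugeAction f r s a) =
      gaugeAction g r s (extRuelleCongr φ hφ hφ' a) := by
  refine Subtype.ext ?_
  show conjEquiv φ hφ hφ' (gaugeAd f r s a) = gaugeAd g r s (conjEquiv φ hφ hφ' a)
  ext ξ γ
  rw [conjEquiv_apply_apply, gaugeAd_apply_apply, gaugeAd_apply_apply, mulUnitary_apply,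
    mulUnitary_apply, phase_congr_symm φ hφ hφ' hfg, conjEquiv_apply_apply]
  refine congrArg (fun ζ => (phase g r s γ : ℂ) * (a : L2 A →L[ℂ] L2 A) ζ _) ?_
  ext δ
  show ((phase f r s δ)⁻¹ : Circle) * ξ _ = ((phase g r s _)⁻¹ : Circle) * ξ _
  rw [← phase_congr_symm φ hφ hφ' hfg]
  congr 4
  exact ((Gsu.congr φ hφ hφ').symm_apply_apply δ).symm

end Conjugacy

end MarkovShift

end

theorem proposition5p4 {N M : ℕ}
    (A : Matrix (Fin N) (Fin N) ℤ) (B : Matrix (Fin M) (Fin M) ℤ)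
    (hA01 : ∀ i j, A i j = 0 ∨ A i j = 1) (hAirr : A.IsIrreducible)
    (hAperm : ∀ π : Equiv.Perm (Fin N), A ≠ π.permMatrix ℤ)
    (hB01 : ∀ i j, B i j = 0 ∨ B i j = 1) (hBirr : B.IsIrreducible)
    (hBperm : ∀ π : Equiv.Perm (Fin M), B ≠ π.permMatrix ℤ)
    (φ : MarkovShift.ShiftSpace A ≃ₜ MarkovShift.ShiftSpace B)
    (hφ : ∀ x, φ (MarkovShift.shift x) = MarkovShift.shift (φ x))
    (f : C(MarkovShift.ShiftSpace A, ℤ)) (g : C(MarkovShift.ShiftSpace B, ℤ))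
    (hfg : ∀ x, f x = g (φ x)) :
    ∃ Φ : MarkovShift.extRuelle A ≃⋆ₐ[ℂ] MarkovShift.extRuelle B,
      Φ '' MarkovShift.diagonal A = MarkovShift.diagonal B ∧
      ∀ (r s : UnitAddCircle) (a : MarkovShift.extRuelle A),
        Φ (MarkovShift.gaugeAction f r s a) = MarkovShift.gaugeAction g r s (Φ a) := by
  have hφ' : ∀ x, φ.symm (MarkovShift.shift x) = MarkovShift.shift (φ.symm x) := fun x => by
    rw [φ.symm_apply_eq, hφ, φ.apply_symm_apply]
  exact ⟨MarkovShift.extRuelleCongr φ hφ hφ',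
    MarkovShift.extRuelleCongr_image_diagonal φ hφ hφ',
    MarkovShift.extRuelleCongr_gaugeAction φ hφ hφ' hfg⟩
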